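/- Let $n \ge 2$ and let $\mathbb{L}^n = \{x \in \mathbb{R}^n \mid x_1 \ge \sqrt{x_2^2 + \cdots + x_n^2}\}$ be the second-order cone, with boundary $\partial\mathbb{L}^n$. Let $\mathbb{S}^n$ be the space of real symmetric $n \times n$ matrices with the inner product $\langle A, B\rangle = \sum_{i,j} A_{ij}B_{ij}$, let $\mathcal{COP}(\mathbb{L}^n) = \{A \in \mathbb{S}^n \mid x^\top A x \ge 0 \text{ for all } x \in \mathbb{L}^n\}$ be the copositive cone over $\mathbb{L}^n$, and let $J_n = \mathrm{diag}(1, -1, \dots, -1) \in \mathbb{S}^n$. For an element $X$ of a real vector space, $\mathbb{R}_+X = \{\alpha X \mid \alpha \ge 0\}$. A face of a closed convex cone $K$ is a nonempty convex subcone $F \subseteq K$ such that $a, b \in K$ and $a + b \in F$ imply $a, b \in F$. An extreme ray of $K$ is a face whose linear span is one-dimensional. A face $F$ of $K$ is exposed if $F = \{H\}^\perp \cap K$ for some $H$ in the dual cone $K^*$. Every extreme ray of $\mathcal{COP}(\mathbb{L}^n)$ falls into one of the following three families: (i) $\mathbb{R}_+xx^\top$ with $x \in \mathbb{R}^n \setminus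 (\mathbb{L}^n \cup (-\mathbb{L}^n))$; (ii) $\mathbb{R}_+J_n$; (iii) $\mathbb{R}_+xx^\top$ with $x \in \partial\mathbb{L}^n \setminus \{0\}$. Conversely, all the rays of the form (i), (ii) or (iii) are extreme rays of $\mathcal{COP}(\mathbb{L}^n)$. Furthermore, the rays in (i) and (ii) are exposed faces of $\mathcal{COP}(\mathbb{L}^n)$, and no ray in (iii) is. -/

import Mathlib

open scoped Pointwise

/-! ### Cones, faces and exposed faces -/

section Cones

variable {V : Type*} [AddCommGroup V] [Module ℝ V]

/-- The half-line `ℝ₊ x = {α x | α ≥ 0}` as a convex cone. -/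
def rayCone (x : V) : PointedCone ℝ V where
  carrier := {y | ∃ α : ℝ, 0 ≤ α ∧ y = α • x}
  add_mem' := by
    rintro a b ⟨α, hα, rfl⟩ ⟨β, hβ, rfl⟩
    exact ⟨α + β, add_nonneg hα hβ, (add_smul α β x).symm⟩
  zero_mem' := ⟨0, le_rfl, (zero_smul ℝ x).symm⟩
  smul_mem' := by
    rintro ⟨c, hc⟩ y ⟨α, hα, rfl⟩
    exact ⟨c * α, mul_nonneg hc hα, (mul_smul c α x).symm⟩

/-- The dimension of a cone: the dimension of its linear span. -/
noncomputable def coneDim (F : PointedCone ℝ V) : ℕ :=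
  Module.finrank ℝ (Submodule.span ℝ (F : Set V))

/-- An extreme ray of a convex cone `K` is a one-dimensional face of `K`. -/
def IsExtremeRay (F K : PointedCone ℝ V) : Prop :=
  F.IsFaceOf K ∧ coneDim F = 1

/-- A face `F` of `K` is exposed if `F = {x}^⊥ ∩ K` for some `x` in the dual cone `K^*`. Here `p`
is the inner product of the ambient space. -/
def IsExposedFace (p : V →ₗ[ℝ] V →ₗ[ℝ] ℝ) (F K : PointedCone ℝ V) : Prop :=
  F.IsFaceOf K ∧
    ∃ x ∈ PointedCone.dual p (K : Set V), (F : Set V) = {y | p x y = 0} ∩ (K : Set V)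

end Cones

/-! ### Symmetric matrices -/

/-- The space `𝕊ⁿ` of real symmetric `n × n` matrices. -/
def symMat (n : ℕ) : Submodule ℝ (Matrix (Fin n) (Fin n) ℝ) where
  carrier := {A | A.IsSymm}
  add_mem' := fun hA hB => Matrix.IsSymm.add hA hB
  zero_mem' := Matrix.isSymm_zero
  smul_mem' := fun c _ hA => Matrix.IsSymm.smul hA c

/-- The inner product `⟨A, B⟩ = ∑ i j, A i j * B i j` on `𝕊ⁿ`. -/
def symInner (n : ℕ) : symMat n →ₗ[ℝ] symMat n →ₗ[ℝ] ℝ :=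
  LinearMap.mk₂ ℝ (fun A B => ∑ i, ∑ j, A.1 i j * B.1 i j)
    (by intro A A' B; simp [add_mul, Finset.sum_add_distrib])
    (by intro c A B; simp [Finset.mul_sum, mul_assoc])
    (by intro A B B'; simp [mul_add, Finset.sum_add_distrib])
    (by intro c A B; simp [Finset.mul_sum, mul_left_comm])

/-- The symmetric matrix `x xᵀ`. -/
def symSquare {n : ℕ} (x : Fin n → ℝ) : symMat n :=
  ⟨Matrix.vecMulVec x x, by
    change (Matrix.vecMulVec x x).IsSymm
    ext i j
    simp [Matrix.vecMulVec_apply, mul_comm]⟩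

/-- The diagonal matrix `J` of size `m + 1` with diagonal `(1, -1, …, -1)`. -/
def symJ (m : ℕ) : symMat (m + 1) :=
  ⟨Matrix.diagonal (Fin.cons 1 (fun _ => -1)), Matrix.isSymm_diagonal _⟩

/-! ### The second-order cone and copositive cones -/

/-- The second-order cone of dimension `n = m + 1`: the vectors of `ℝⁿ` whose first coordinate is at
least the Euclidean norm of the vector of the other `m` coordinates. (Only the topology of
`Fin (m + 1) → ℝ` is used, which is the Euclidean one; the norm is written out.) -/
def secondOrderCone (m : ℕ) : Set (Fin (m + 1) → ℝ) :=
  {x | √(∑ i : Fin m, x i.succ ^ 2) ≤ x 0}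

/-- The copositive cone over `K`: the symmetric matrices `A` with `xᵀ A x ≥ 0` for all `x ∈ K`. -/
def copositiveCone {n : ℕ} (K : Set (Fin n → ℝ)) : PointedCone ℝ (symMat n) where
  carrier := {A | ∀ x ∈ K, 0 ≤ x ⬝ᵥ A.1.mulVec x}
  add_mem' := by
    intro A B hA hB x hx
    simpa [Matrix.add_mulVec, dotProduct_add] using add_nonneg (hA x hx) (hB x hx)
  zero_mem' := by intro x _; simp
  smul_mem' := by
    rintro ⟨c, hc⟩ A hA x hx
    have h : ((⟨c, hc⟩ : {c : ℝ // 0 ≤ c}) • A).1 = c • A.1 := rfl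
    simpa [h, Matrix.smul_mulVec, dotProduct_smul] using mul_nonneg hc (hA x hx)

/-! ### Quadratic forms and the S-lemma -/

/-- If `f` is nonnegative wherever `g` is, then `f / g` is at least as large at points where `g` is
positive as at points where `g` is negative: compare `f` at the two zeros of `g` on the line through
`x` in direction `y`. -/
theorem QuadraticForm.mul_le_mul_of_nonneg_on {V : Type*} [AddCommGroup V] [Module ℝ V]
    {f g : QuadraticForm ℝ V} (h : ∀ x, 0 ≤ g x → 0 ≤ f x) {x y : V} (hx : 0 < g x)
    (hy : g y < 0) : f x * g y ≤ f y * g x := by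
  have expand : ∀ (F : QuadraticForm ℝ V) (s : ℝ),
      F (x + s • y) = F x + s * QuadraticMap.polar F x y + s ^ 2 * F y := by
    intro F s
    rw [QuadraticMap.map_add F, QuadraticMap.map_smul, QuadraticMap.polar_smul_right]
    simp only [smul_eq_mul]
    ring
  set p := QuadraticMap.polar g x y
  set D := √(p ^ 2 - 4 * g y * g x)
  have hneg : g y * g x < 0 := mul_neg_of_neg_of_pos hy hx
  have hD : D ^ 2 = p ^ 2 - 4 * g y * g x := Real.sq_sqrt (by nlinarith [sq_nonneg p])
  have hD0 : 0 < D := Real.sqrt_pos.2 (by nlinarith [sq_nonneg p])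
  have root : ∀ s : ℝ, g x + s * p + s ^ 2 * g y = 0 →
      0 ≤ f x + s * QuadraticMap.polar f x y + s ^ 2 * f y := by
    intro s hs
    rw [← expand f]
    exact h _ (by rw [expand g, hs])
  have hy' := hy.ne
  obtain ⟨s, hs⟩ : ∃ s, s = (-p - D) / (2 * g y) := ⟨_, rfl⟩
  obtain ⟨t, ht⟩ : ∃ t, t = (-p + D) / (2 * g y) := ⟨_, rfl⟩
  have hs' : s * (2 * g y) = -p - D := by rw [hs]; field_simp
  have ht' : t * (2 * g y) = -p + D := by rw [ht]; field_simp
  have hst : s * t * g y = g x := by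
    rw [hs, ht]; field_simp; linear_combination -hD
  have hlt : 0 < s - t := by nlinarith
  have hneg' : s * t < 0 := by nlinarith
  have hs0 : 0 < s := by
    by_contra hc
    nlinarith
  have ht0 : t < 0 := by
    by_contra hc
    nlinarith
  have hfs := root s (by
    have : 4 * g y * (g x + s * p + s ^ 2 * g y) = 0 := by
      linear_combination (s * (2 * g y) + p - D) * hs' + hD
    have h4 : 4 * g y ≠ 0 := by simpa using hy'
    exact (mul_eq_zero.1 this).resolve_left h4)
  have hft := root t (by
    have : 4 * g y * (g x + t * p + t ^ 2 * g y) = 0 := by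
      linear_combination (t * (2 * g y) + p + D) * ht' + hD
    have h4 : 4 * g y ≠ 0 := by simpa using hy'
    exact (mul_eq_zero.1 this).resolve_left h4)
  have key : 0 ≤ (s - t) * (f x - s * t * f y) := by
    nlinarith [mul_nonneg hs0.le hft, mul_nonneg (neg_nonneg.2 ht0.le) hfs]
  have key' : 0 ≤ f x - s * t * f y := nonneg_of_mul_nonneg_right key hlt
  have : g x * f y = s * t * f y * g y := by rw [← hst]; ring
  nlinarith

/-- The S-lemma: if `f` is nonnegative wherever `g` is and `g` takes a positive value, then
`f - t g` is nonnegative for some `t ≥ 0`. -/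
theorem QuadraticForm.exists_mul_le_of_nonneg_on {V : Type*} [AddCommGroup V] [Module ℝ V]
    {f g : QuadraticForm ℝ V} (hg : ∃ x, 0 < g x) (h : ∀ x, 0 ≤ g x → 0 ≤ f x) :
    ∃ t : ℝ, 0 ≤ t ∧ ∀ x, t * g x ≤ f x := by
  set S : Set ℝ := insert 0 {r | ∃ y, g y < 0 ∧ r = f y / g y}
  have bound : ∀ x, 0 < g x → f x / g x ∈ upperBounds S := by
    rintro x hx r (rfl | ⟨y, hy, rfl⟩)
    · exact div_nonneg (h x hx.le) hx.le
    · rw [div_le_iff_of_neg hy, div_mul_eq_mul_div, div_le_iff₀ hx]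
      exact mul_le_mul_of_nonneg_on h hx hy
  obtain ⟨x₀, hx₀⟩ := hg
  have hS : BddAbove S := ⟨_, bound x₀ hx₀⟩
  refine ⟨sSup S, le_csSup hS (Set.mem_insert _ _), fun x => ?_⟩
  rcases lt_trichotomy (g x) 0 with hx | hx | hx
  · rw [← div_le_iff_of_neg hx]
    exact le_csSup hS (Set.mem_insert_of_mem _ ⟨x, hx, rfl⟩)
  · rw [hx, mul_zero]
    exact h x hx.ge
  · rw [← le_div_iff₀ hx]
    exact csSup_le ⟨0, Set.mem_insert _ _⟩ (bound x hx)

/-! ### Rays and faces -/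

section Rays

variable {V : Type*} [AddCommGroup V] [Module ℝ V]

theorem self_mem_rayCone (x : V) : x ∈ rayCone x := ⟨1, zero_le_one, (one_smul ℝ x).symm⟩

theorem coneDim_rayCone {x : V} (hx : x ≠ 0) : coneDim (rayCone x) = 1 := by
  have : Submodule.span ℝ (rayCone x : Set V) = Submodule.span ℝ {x} := by
    refine le_antisymm (Submodule.span_le.2 ?_)
      (Submodule.span_mono (Set.singleton_subset_iff.2 (self_mem_rayCone x)))
    rintro _ ⟨α, -, rfl⟩
    exact Submodule.smul_mem _ _ (Submodule.mem_span_singleton_self x)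
  rw [coneDim, this, finrank_span_singleton hx]

/-- A one-dimensional cone in a salient cone is the ray through any of its nonzero elements. -/
theorem eq_rayCone_of_coneDim_eq_one {F K : PointedCone ℝ V} (hFK : F ≤ K)
    (hK : ∀ x ∈ K, -x ∈ K → x = 0) (hF : coneDim F = 1) {x : V} (hx : x ∈ F) (hx0 : x ≠ 0) :
    F = rayCone x := by
  refine le_antisymm (fun y hy => ?_) ?_
  · have hxs : x ∈ Submodule.span ℝ (F : Set V) := Submodule.subset_span hx
    have hys : y ∈ Submodule.span ℝ (F : Set V) := Submodule.subset_span hy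
    obtain ⟨c, hc⟩ := (finrank_eq_one_iff_of_nonzero' (⟨x, hxs⟩ : Submodule.span ℝ (F : Set V))
      (by simpa using hx0)).1 hF ⟨y, hys⟩
    have hcy : c • x = y := congrArg Subtype.val hc
    refine ⟨c, ?_, hcy.symm⟩
    by_contra hneg
    push Not at hneg
    apply hx0
    refine hK x (hFK hx) (hFK ?_)
    have h1 : -x = (-c)⁻¹ • y := by
      rw [← hcy, smul_smul, ← neg_one_smul ℝ x]
      congr 1
      rw [inv_neg, neg_mul, inv_mul_cancel₀ hneg.ne]
    rw [h1]
    exact F.smul_mem (by rw [inv_nonneg]; linarith) hy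
  · rintro _ ⟨α, hα, rfl⟩
    exact F.smul_mem hα hx

/-- A cone cut out of `K` by a supporting hyperplane is an exposed face. -/
theorem isExposedFace_of_eq {p : V →ₗ[ℝ] V →ₗ[ℝ] ℝ} (hp : ∀ x y, p x y = p y x)
    {F K : PointedCone ℝ V} {H : V} (hH : ∀ A ∈ K, 0 ≤ p H A)
    (hF : ∀ A, A ∈ F ↔ p H A = 0 ∧ A ∈ K) : IsExposedFace p F K := by
  refine ⟨⟨fun A hA => ((hF A).1 hA).2, ?_⟩, H, ?_, Set.ext hF⟩
  · intro A B a hA hB ha hAB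
    rw [hF] at hAB ⊢
    refine ⟨?_, hA⟩
    have h := hAB.1
    rw [map_add, map_smul, smul_eq_mul] at h
    have := hH A hA
    have := hH B hB
    have h0 : a * p H A = 0 := by nlinarith [mul_nonneg ha.le (hH A hA)]
    exact (mul_eq_zero.1 h0).resolve_left ha.ne'
  · intro A hA
    rw [hp]
    exact hH A hA

end Rays

/-! ### Symmetric matrices -/

section SymMat

variable {n : ℕ}

theorem symInner_apply (A B : symMat n) : symInner n A B = ∑ i, ∑ j, A.1 i j * B.1 i j := rfl

theorem symInner_comm (A B : symMat n) : symInner n A B = symInner n B A := by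
  simp only [symInner_apply, mul_comm]

theorem symInner_symSquare (A : symMat n) (x : Fin n → ℝ) :
    symInner n A (symSquare x) = x ⬝ᵥ A.1.mulVec x := by
  simp only [symInner_apply, symSquare, Matrix.vecMulVec_apply, dotProduct, Matrix.mulVec,
    Finset.mul_sum]
  refine Finset.sum_congr rfl fun i _ => Finset.sum_congr rfl fun j _ => ?_
  ring

theorem dotProduct_symSquare_mulVec (x y : Fin n → ℝ) :
    y ⬝ᵥ (symSquare x).1.mulVec y = (x ⬝ᵥ y) ^ 2 := by
  simp [symSquare, Matrix.vecMulVec_mulVec, dotProduct_comm, sq]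

theorem symInner_symSquare_symSquare (x y : Fin n → ℝ) :
    symInner n (symSquare x) (symSquare y) = (x ⬝ᵥ y) ^ 2 := by
  rw [symInner_symSquare, dotProduct_symSquare_mulVec]

theorem symSquare_ne_zero {x : Fin n → ℝ} (hx : x ≠ 0) : symSquare x ≠ 0 := by
  intro h
  have h1 := dotProduct_symSquare_mulVec x x
  rw [h] at h1
  exact hx (by simpa [eq_comm (a := (0 : ℝ))] using h1)

theorem symSquare_zero : symSquare (0 : Fin n → ℝ) = 0 := by
  ext i j
  simp [symSquare]

theorem symSquare_neg (x : Fin n → ℝ) : symSquare (-x) = symSquare x := by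
  ext i j
  simp [symSquare, Matrix.vecMulVec_apply]

theorem symSquare_smul (c : ℝ) (x : Fin n → ℝ) : symSquare (c • x) = c ^ 2 • symSquare x := by
  ext i j
  simp [symSquare, Matrix.vecMulVec_apply]
  ring

theorem symSquare_add_add_symSquare_sub (x y : Fin n → ℝ) :
    symSquare (x + y) + symSquare (x - y) = (2 : ℝ) • symSquare x + (2 : ℝ) • symSquare y := by
  ext i j
  simp [symSquare, Matrix.vecMulVec_apply]
  ring

theorem symSquare_mem_copositiveCone (K : Set (Fin n → ℝ)) (x : Fin n → ℝ) :
    symSquare x ∈ copositiveCone K := by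
  intro y _
  rw [dotProduct_symSquare_mulVec]
  positivity

/-- Positive semidefinite matrices are sums of squares of vectors. -/
theorem exists_eq_sum_symSquare {A : symMat n} (hA : ∀ x, 0 ≤ x ⬝ᵥ A.1.mulVec x) :
    ∃ (k : ℕ) (v : Fin k → Fin n → ℝ), A = ∑ i, symSquare (v i) := by
  have h : A.1.PosSemidef := .of_dotProduct_mulVec_nonneg (A.2 : A.1.IsSymm) (by simpa using hA)
  obtain ⟨k, v, hv⟩ := Matrix.posSemidef_iff_eq_sum_vecMulVec.1 h
  refine ⟨k, v, Subtype.ext ?_⟩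
  rw [hv, AddSubmonoidClass.coe_finsetSum]
  rfl

/-- The equality case of the Cauchy-Schwarz inequality. -/
theorem exists_eq_smul_of_dotProduct_sq_eq {x v : Fin n → ℝ} (hx : x ≠ 0)
    (h : (x ⬝ᵥ x) * (v ⬝ᵥ v) = (x ⬝ᵥ v) ^ 2) : ∃ c : ℝ, v = c • x := by
  have hxx : x ⬝ᵥ x ≠ 0 := by simpa using hx
  have h0 : v - (x ⬝ᵥ v / x ⬝ᵥ x) • x = 0 := by
    rw [← dotProduct_self_eq_zero]
    simp only [sub_dotProduct, dotProduct_sub, smul_dotProduct, dotProduct_smul, smul_eq_mul]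
    rw [dotProduct_comm v x]
    field_simp
    linear_combination h
  exact ⟨_, sub_eq_zero.1 h0⟩

theorem sum_symSquare_mem_rayCone {k : ℕ} {v : Fin k → Fin n → ℝ} {x : Fin n → ℝ}
    (h : ∀ i, ∃ c : ℝ, v i = c • x) : ∑ i, symSquare (v i) ∈ rayCone (symSquare x) := by
  refine Submodule.sum_mem _ fun i _ => ?_
  obtain ⟨c, hc⟩ := h i
  exact ⟨c ^ 2, sq_nonneg c, by rw [hc, symSquare_smul]⟩

theorem dotProduct_sq_le (x v : Fin n → ℝ) : (x ⬝ᵥ v) ^ 2 ≤ (x ⬝ᵥ x) * (v ⬝ᵥ v) := by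
  simpa [dotProduct, sq] using Finset.sum_mul_sq_le_sq_mul_sq Finset.univ x v

end SymMat

/-! ### The Lorentz form and the second-order cone -/

section Lorentz

variable {m : ℕ}

/-- The Lorentz form `x₀² - x₁² - ⋯ - xₘ²`. -/
def lorentzForm (x : Fin (m + 1) → ℝ) : ℝ := x 0 ^ 2 - ∑ i : Fin m, x i.succ ^ 2

/-- The vector `J x`, that is, `x` with all coordinates but the first negated. -/
def timeReflect (x : Fin (m + 1) → ℝ) : Fin (m + 1) → ℝ := Fin.cons (x 0) fun i => -x i.succ

theorem symJ_mulVec (x : Fin (m + 1) → ℝ) : (symJ m).1.mulVec x = timeReflect x := by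
  ext i
  refine Fin.cases ?_ (fun j => ?_) i <;> simp [symJ, timeReflect, Matrix.mulVec_diagonal]

theorem dotProduct_timeReflect_self (x : Fin (m + 1) → ℝ) :
    x ⬝ᵥ timeReflect x = lorentzForm x := by
  simp [dotProduct, timeReflect, lorentzForm, Fin.sum_univ_succ, sq, sub_eq_add_neg]

theorem timeReflect_dotProduct_timeReflect (x y : Fin (m + 1) → ℝ) :
    timeReflect x ⬝ᵥ timeReflect y = x ⬝ᵥ y := by
  simp [dotProduct, timeReflect, Fin.sum_univ_succ]

theorem timeReflect_timeReflect (x : Fin (m + 1) → ℝ) : timeReflect (timeReflect x) = x := by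
  ext i
  refine Fin.cases ?_ (fun j => ?_) i <;> simp [timeReflect]

theorem dotProduct_timeReflect_comm (x y : Fin (m + 1) → ℝ) :
    x ⬝ᵥ timeReflect y = timeReflect x ⬝ᵥ y := by
  rw [← timeReflect_dotProduct_timeReflect, timeReflect_timeReflect]

theorem lorentzForm_smul_add_smul (a s : ℝ) (x y : Fin (m + 1) → ℝ) :
    lorentzForm (a • x + s • y) =
      a ^ 2 * lorentzForm x + 2 * a * s * (x ⬝ᵥ timeReflect y) + s ^ 2 * lorentzForm y := by
  have h : y ⬝ᵥ timeReflect x = x ⬝ᵥ timeReflect y := by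
    rw [dotProduct_timeReflect_comm, dotProduct_comm]
  simp only [← dotProduct_timeReflect_self, ← symJ_mulVec, Matrix.mulVec_add, Matrix.mulVec_smul,
    dotProduct_add, add_dotProduct, smul_dotProduct, dotProduct_smul, smul_eq_mul] at h ⊢
  rw [h]
  ring

theorem lorentzForm_add_smul (x y : Fin (m + 1) → ℝ) (s : ℝ) :
    lorentzForm (x + s • y) =
      lorentzForm x + 2 * s * (x ⬝ᵥ timeReflect y) + s ^ 2 * lorentzForm y := by
  simpa using lorentzForm_smul_add_smul 1 s x y

theorem lorentzForm_timeReflect (x : Fin (m + 1) → ℝ) :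
    lorentzForm (timeReflect x) = lorentzForm x := by
  simp [lorentzForm, timeReflect]

theorem lorentzForm_neg (x : Fin (m + 1) → ℝ) : lorentzForm (-x) = lorentzForm x := by
  simp [lorentzForm]

/-- The reversed Cauchy-Schwarz inequality. -/
theorem lorentzForm_mul_le_sq {u : Fin (m + 1) → ℝ} (hu : 0 < lorentzForm u)
    (x : Fin (m + 1) → ℝ) : lorentzForm u * lorentzForm x ≤ (u ⬝ᵥ timeReflect x) ^ 2 := by
  have hu0 : 0 < u 0 ^ 2 := by
    have : 0 ≤ ∑ i : Fin m, u i.succ ^ 2 := Finset.sum_nonneg fun i _ => sq_nonneg _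
    unfold lorentzForm at hu
    linarith
  have hw : lorentzForm ((-x 0) • u + u 0 • x) ≤ 0 := by
    have : 0 ≤ ∑ i : Fin m, (((-x 0) • u + u 0 • x) i.succ) ^ 2 :=
      Finset.sum_nonneg fun i _ => sq_nonneg _
    have h0 : ((-x 0) • u + u 0 • x) 0 = 0 := by simp; ring
    unfold lorentzForm
    rw [h0]
    linarith
  rw [lorentzForm_smul_add_smul] at hw
  have h1 := mul_nonpos_of_nonneg_of_nonpos hu.le hw
  have h2 : u 0 ^ 2 * (lorentzForm u * lorentzForm x - (u ⬝ᵥ timeReflect x) ^ 2) ≤ 0 := by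
    nlinarith [sq_nonneg (x 0 * lorentzForm u - u 0 * (u ⬝ᵥ timeReflect x))]
  have := nonpos_of_mul_nonpos_right h2 hu0
  linarith

theorem lorentzForm_nonneg_of_mem {x : Fin (m + 1) → ℝ} (hx : x ∈ secondOrderCone m) :
    0 ≤ lorentzForm x := by
  have h : √(∑ i : Fin m, x i.succ ^ 2) ≤ x 0 := hx
  have h0 := (Real.sqrt_nonneg _).trans h
  have := (Real.sqrt_le_left h0).1 h
  unfold lorentzForm
  linarith

theorem mem_secondOrderCone_iff {x : Fin (m + 1) → ℝ} :
    x ∈ secondOrderCone m ↔ 0 ≤ x 0 ∧ 0 ≤ lorentzForm x := by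
  refine ⟨fun h => ⟨(Real.sqrt_nonneg _).trans h, lorentzForm_nonneg_of_mem h⟩, fun h => ?_⟩
  refine (Real.sqrt_le_left h.1).2 ?_
  have := h.2
  unfold lorentzForm at this
  linarith

theorem mem_secondOrderCone_union_neg_iff {x : Fin (m + 1) → ℝ} :
    x ∈ secondOrderCone m ∪ -secondOrderCone m ↔ 0 ≤ lorentzForm x := by
  simp only [Set.mem_union, Set.mem_neg, mem_secondOrderCone_iff, lorentzForm_neg, Pi.neg_apply,
    Left.nonneg_neg_iff]
  have := le_total 0 (x 0)
  tauto

theorem continuous_lorentz_sqrt :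
    Continuous fun x : Fin (m + 1) → ℝ => √(∑ i : Fin m, x i.succ ^ 2) := by
  fun_prop

theorem mem_frontier_secondOrderCone_iff {x : Fin (m + 1) → ℝ} :
    x ∈ frontier (secondOrderCone m) ↔ 0 ≤ x 0 ∧ lorentzForm x = 0 := by
  constructor
  · intro h
    have h' : √(∑ i : Fin m, x i.succ ^ 2) = x 0 :=
      frontier_le_subset_eq continuous_lorentz_sqrt (continuous_apply 0) h
    refine ⟨h' ▸ Real.sqrt_nonneg _, ?_⟩
    rw [lorentzForm, ← h', Real.sq_sqrt (Finset.sum_nonneg fun i _ => sq_nonneg _), sub_self]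
  · rintro ⟨h0, h⟩
    refine ⟨subset_closure (mem_secondOrderCone_iff.2 ⟨h0, h.ge⟩), fun hint => ?_⟩
    have hc : Continuous fun s : ℝ => x - s • (Pi.single 0 1 : Fin (m + 1) → ℝ) := by fun_prop
    have hev : ∀ᶠ s in nhdsWithin (0 : ℝ) (Set.Ioi 0),
        x - s • (Pi.single 0 1 : Fin (m + 1) → ℝ) ∈ secondOrderCone m := by
      refine Filter.Eventually.filter_mono nhdsWithin_le_nhds ?_
      refine hc.continuousAt.eventually (f := fun s : ℝ => x - s • _) ?_
      simpa using mem_interior_iff_mem_nhds.1 hint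
    obtain ⟨s, hs, hs0⟩ := (hev.and self_mem_nhdsWithin).exists
    have hs0 : 0 < s := hs0
    have hs : √(∑ i : Fin m, x i.succ ^ 2) ≤ x 0 - s := by
      have h1 : √(∑ i : Fin m, (x - s • (Pi.single 0 1 : Fin (m + 1) → ℝ)) i.succ ^ 2) ≤
        (x - s • (Pi.single 0 1 : Fin (m + 1) → ℝ)) 0 := hs
      simpa using h1
    have h1 : √(∑ i : Fin m, x i.succ ^ 2) = x 0 := by
      rw [Real.sqrt_eq_iff_eq_sq (Finset.sum_nonneg fun i _ => sq_nonneg _) h0]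
      unfold lorentzForm at h
      linarith
    linarith

end Lorentz

/-! ### The copositive cone over the second-order cone -/

section Copositive

variable {m : ℕ}

theorem dotProduct_symJ_mulVec (x : Fin (m + 1) → ℝ) :
    x ⬝ᵥ (symJ m).1.mulVec x = lorentzForm x := by
  rw [symJ_mulVec, dotProduct_timeReflect_self]

theorem symJ_mem_copositiveCone : symJ m ∈ copositiveCone (secondOrderCone m) := fun x hx => by
  rw [dotProduct_symJ_mulVec]
  exact lorentzForm_nonneg_of_mem hx

theorem symJ_ne_zero : symJ m ≠ 0 := by
  intro h
  have := congrArg (fun A : symMat (m + 1) => A.1 0 0) h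
  simp [symJ] at this

theorem symJ_ne_smul_symSquare (hm : 1 ≤ m) (c : ℝ) (x : Fin (m + 1) → ℝ) :
    symJ m ≠ c • symSquare x := by
  intro h
  have h0 := congrArg (fun A : symMat (m + 1) => A.1 0 0) h
  have h1 := congrArg
    (fun A : symMat (m + 1) => A.1 (Fin.succ ⟨0, hm⟩) (Fin.succ ⟨0, hm⟩)) h
  simp only [symJ, symSquare, Matrix.diagonal_apply_eq, Fin.cons_zero, Fin.cons_succ,
    SetLike.val_smul, Matrix.smul_apply, Matrix.vecMulVec_apply, smul_eq_mul] at h0 h1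
  have : (c * (x 0 * x (Fin.succ ⟨0, hm⟩))) ^ 2 = -1 := by
    linear_combination h0 - c * (x 0 * x 0) * h1
  linarith [sq_nonneg (c * (x 0 * x (Fin.succ ⟨0, hm⟩)))]

/-- Every copositive matrix over the second-order cone is a sum of a nonnegative multiple of `J`
and squares of vectors. -/
theorem exists_eq_smul_symJ_add_sum_symSquare {A : symMat (m + 1)}
    (hA : A ∈ copositiveCone (secondOrderCone m)) :
    ∃ t : ℝ, 0 ≤ t ∧ ∃ (k : ℕ) (v : Fin k → Fin (m + 1) → ℝ),
      A = t • symJ m + ∑ i, symSquare (v i) := by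
  have hf : ∀ (B : symMat (m + 1)) x, B.1.toQuadraticForm' x = x ⬝ᵥ B.1.mulVec x := by
    intro B x
    simp [Matrix.toQuadraticForm', Matrix.toLinearMap₂'_apply']
  obtain ⟨t, ht, h⟩ := QuadraticForm.exists_mul_le_of_nonneg_on
    (f := A.1.toQuadraticForm') (g := (symJ m).1.toQuadraticForm')
    ⟨Pi.single 0 1, by rw [hf, dotProduct_symJ_mulVec]; simp [lorentzForm]⟩ (fun x hx => by
      rw [hf, dotProduct_symJ_mulVec, ← mem_secondOrderCone_union_neg_iff] at hx
      rw [hf]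
      rcases hx with hx | hx
      · exact hA x hx
      · simpa [Matrix.mulVec_neg] using hA (-x) hx)
  obtain ⟨k, v, hv⟩ := exists_eq_sum_symSquare (A := A - t • symJ m) (fun x => by
    have := h x
    rw [hf, hf] at this
    simpa [Matrix.sub_mulVec, Matrix.smul_mulVec, dotProduct_sub, dotProduct_smul] using this)
  exact ⟨t, ht, k, v, by rw [← hv]; abel⟩

/-- `v vᵀ - q(v) J` is copositive when `v` is interior to the cone or its opposite. -/
theorem symSquare_sub_smul_symJ_mem {v : Fin (m + 1) → ℝ} (hv : 0 < lorentzForm v) :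
    symSquare v - lorentzForm v • symJ m ∈ copositiveCone (secondOrderCone m) := by
  intro x _
  have h := lorentzForm_mul_le_sq (u := timeReflect v) (by rwa [lorentzForm_timeReflect]) x
  rw [timeReflect_dotProduct_timeReflect, lorentzForm_timeReflect] at h
  have h1 := dotProduct_symSquare_mulVec v x
  have h2 := dotProduct_symJ_mulVec x
  simp only [Submodule.coe_sub, SetLike.val_smul, Matrix.sub_mulVec, Matrix.smul_mulVec,
    dotProduct_sub, dotProduct_smul, h1, h2, smul_eq_mul]
  linarith

/-- The copositive cone is salient. -/
theorem eq_zero_of_mem_of_neg_mem {A : symMat (m + 1)}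
    (hA : A ∈ copositiveCone (secondOrderCone m))
    (hA' : -A ∈ copositiveCone (secondOrderCone m)) : A = 0 := by
  obtain ⟨t, ht, k, v, rfl⟩ := exists_eq_smul_symJ_add_sum_symSquare hA
  have key : ∀ x ∈ secondOrderCone m, t * lorentzForm x = 0 ∧ ∀ i, v i ⬝ᵥ x = 0 := by
    intro x hx
    have h := hA' x hx
    have e : x ⬝ᵥ (-(t • symJ m + ∑ i, symSquare (v i))).1.mulVec x =
        -(t * lorentzForm x + ∑ i, (v i ⬝ᵥ x) ^ 2) := by
      rw [← symInner_symSquare, symInner_comm, map_neg, map_add, map_smul, map_sum,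
        symInner_comm, symInner_symSquare, dotProduct_symJ_mulVec]
      simp only [symInner_symSquare_symSquare, smul_eq_mul, dotProduct_comm x]
    rw [e] at h
    have h1 := mul_nonneg ht (lorentzForm_nonneg_of_mem hx)
    have h2 : 0 ≤ ∑ i, (v i ⬝ᵥ x) ^ 2 := Finset.sum_nonneg fun i _ => sq_nonneg _
    refine ⟨by linarith, fun i => ?_⟩
    have h3 : ∑ i, (v i ⬝ᵥ x) ^ 2 = 0 := by linarith
    have := (Finset.sum_eq_zero_iff_of_nonneg fun i _ => sq_nonneg (v i ⬝ᵥ x)).1 h3 i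
      (Finset.mem_univ i)
    simpa using this
  have he : (Pi.single 0 1 : Fin (m + 1) → ℝ) ∈ secondOrderCone m := by
    rw [mem_secondOrderCone_iff]
    simp [lorentzForm]
  have ht0 : t = 0 := by simpa [lorentzForm] using (key _ he).1
  have hv : ∀ i, v i = 0 := by
    intro i
    have h0 : v i 0 = 0 := by simpa using (key _ he).2 i
    ext j
    refine Fin.cases h0 (fun l => ?_) j
    have hl : (Pi.single 0 1 + Pi.single l.succ 1 : Fin (m + 1) → ℝ) ∈ secondOrderCone m := by
      rw [mem_secondOrderCone_iff]
      simp [lorentzForm, Pi.single_apply]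
    have := (key _ hl).2 i
    simpa [dotProduct_add, h0] using this
  simp [ht0, hv, symSquare_zero]

end Copositive

/-! ### Extreme rays of the copositive cone -/

section ExtremeRays

variable {m : ℕ}

/-- The ray through `J` is exposed by `diag(m, 1, …, 1)`. -/
theorem isExposedFace_rayCone_symJ (hm : 1 ≤ m) :
    IsExposedFace (symInner (m + 1)) (rayCone (symJ m)) (copositiveCone (secondOrderCone m)) := by
  have hm' : (0 : ℝ) < m := by exact_mod_cast hm
  set H : symMat (m + 1) :=
    ⟨Matrix.diagonal (Fin.cons (m : ℝ) fun _ => 1), Matrix.isSymm_diagonal _⟩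
  have hsq : ∀ v, symInner (m + 1) H (symSquare v) = m * v 0 ^ 2 + ∑ i : Fin m, v i.succ ^ 2 := by
    intro v
    rw [symInner_symSquare]
    simp [H, dotProduct, Matrix.mulVec_diagonal, Fin.sum_univ_succ, sq]
    ring
  have hJ : symInner (m + 1) H (symJ m) = 0 := by
    simp [symInner_apply, H, symJ, Matrix.diagonal_apply, Fin.sum_univ_succ]
  have hs : ∀ v : Fin (m + 1) → ℝ, 0 ≤ symInner (m + 1) H (symSquare v) := by
    intro v
    rw [hsq]
    exact add_nonneg (by positivity) (Finset.sum_nonneg fun i _ => sq_nonneg _)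
  refine isExposedFace_of_eq symInner_comm (H := H) (fun A hA => ?_) (fun A => ⟨?_, ?_⟩)
  · obtain ⟨t, ht, k, v, rfl⟩ := exists_eq_smul_symJ_add_sum_symSquare hA
    rw [map_add, map_smul, hJ, map_sum, smul_zero, zero_add]
    exact Finset.sum_nonneg fun i _ => hs _
  · rintro ⟨α, hα, rfl⟩
    refine ⟨by rw [map_smul, hJ, smul_zero], ?_⟩
    exact PointedCone.smul_mem _ hα symJ_mem_copositiveCone
  · rintro ⟨h0, hA⟩
    obtain ⟨t, ht, k, v, rfl⟩ := exists_eq_smul_symJ_add_sum_symSquare hA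
    rw [map_add, map_smul, hJ, map_sum, smul_zero, zero_add] at h0
    have hv : ∀ i, v i = 0 := by
      intro i
      have h := (Finset.sum_eq_zero_iff_of_nonneg fun i _ => hs (v i)).1 h0 i (Finset.mem_univ i)
      rw [hsq] at h
      have h1 : 0 ≤ ∑ j : Fin m, v i j.succ ^ 2 := Finset.sum_nonneg fun i _ => sq_nonneg _
      have h2 : 0 ≤ m * v i 0 ^ 2 := by positivity
      have h3 : ∑ j : Fin m, v i j.succ ^ 2 = 0 := by linarith
      have h4 : m * v i 0 ^ 2 = 0 := by linarith
      ext j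
      refine Fin.cases ?_ (fun l => ?_) j
      · simpa [hm'.ne'] using h4
      · simpa using (Finset.sum_eq_zero_iff_of_nonneg fun j _ => sq_nonneg (v i (Fin.succ j))).1 h3 l
          (Finset.mem_univ l)
    exact ⟨t, ht, by simp [hv, symSquare_zero]⟩

/-- The positive semidefinite matrix `|x|² I - x xᵀ`, whose kernel is spanned by `x`. -/
def orthProj {n : ℕ} (x : Fin n → ℝ) : symMat n :=
  (x ⬝ᵥ x) • ⟨1, Matrix.isSymm_one⟩ - symSquare x

theorem symInner_orthProj_symSquare {n : ℕ} (x v : Fin n → ℝ) :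
    symInner n (orthProj x) (symSquare v) = (x ⬝ᵥ x) * (v ⬝ᵥ v) - (x ⬝ᵥ v) ^ 2 := by
  rw [orthProj, symInner_comm, map_sub, map_smul, symInner_comm, symInner_symSquare,
    symInner_symSquare_symSquare, dotProduct_comm v x]
  simp

/-- A vector outside the double cone is orthogonal to a vector interior to the cone. -/
theorem exists_lorentzForm_pos_of_neg {x : Fin (m + 1) → ℝ} (hx : lorentzForm x < 0) :
    ∃ y, 0 < lorentzForm y ∧ x ⬝ᵥ y = 0 := by
  set S := ∑ i : Fin m, x i.succ ^ 2 with hS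
  have hxS : x 0 ^ 2 < S := by
    unfold lorentzForm at hx
    linarith
  have hS0 : 0 < S := (sq_nonneg _).trans_lt hxS
  refine ⟨Fin.cons S fun i => -(x 0 * x i.succ), ?_, ?_⟩
  · have : ∑ i : Fin m, (x 0 * x i.succ) ^ 2 = x 0 ^ 2 * S := by
      simp only [mul_pow, hS, Finset.mul_sum]
    simp only [lorentzForm, Fin.cons_zero, Fin.cons_succ, neg_sq, this]
    nlinarith
  · have : ∑ i : Fin m, x i.succ * (x 0 * x i.succ) = x 0 * S := by
      rw [hS, Finset.mul_sum]
      exact Finset.sum_congr rfl fun i _ => by ring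
    simp [dotProduct, Fin.sum_univ_succ, this]

/-- The ray through `x xᵀ`, with `x` outside the double cone, is exposed. -/
theorem isExposedFace_rayCone_symSquare {x : Fin (m + 1) → ℝ} (hx : lorentzForm x < 0) :
    IsExposedFace (symInner (m + 1)) (rayCone (symSquare x))
      (copositiveCone (secondOrderCone m)) := by
  have hx0 : x ≠ 0 := by
    rintro rfl
    simp [lorentzForm] at hx
  obtain ⟨y, hy, hxy⟩ := exists_lorentzForm_pos_of_neg hx
  obtain ⟨r, hr0, hr⟩ : ∃ r : ℝ, 0 ≤ r ∧
      0 < r * lorentzForm y + symInner (m + 1) (orthProj x) (symJ m) := by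
    refine ⟨(|symInner (m + 1) (orthProj x) (symJ m)| + 1) / lorentzForm y, by positivity, ?_⟩
    rw [div_mul_cancel₀ _ hy.ne']
    linarith [neg_abs_le (symInner (m + 1) (orthProj x) (symJ m))]
  set H : symMat (m + 1) := r • symSquare y + orthProj x
  have hJ : 0 < symInner (m + 1) H (symJ m) := by
    rw [symInner_comm, map_add, map_smul, symInner_symSquare, dotProduct_symJ_mulVec,
      symInner_comm]
    exact hr
  have hsq : ∀ v, symInner (m + 1) H (symSquare v) =
      r * (y ⬝ᵥ v) ^ 2 + ((x ⬝ᵥ x) * (v ⬝ᵥ v) - (x ⬝ᵥ v) ^ 2) := by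
    intro v
    rw [symInner_comm, map_add, map_smul, symInner_symSquare_symSquare, symInner_comm,
      symInner_orthProj_symSquare, dotProduct_comm v y, smul_eq_mul]
  have hs : ∀ v : Fin (m + 1) → ℝ, 0 ≤ symInner (m + 1) H (symSquare v) := by
    intro v
    rw [hsq]
    exact add_nonneg (by positivity) (sub_nonneg.2 (dotProduct_sq_le x v))
  refine isExposedFace_of_eq symInner_comm (H := H) (fun A hA => ?_) (fun A => ⟨?_, ?_⟩)
  · obtain ⟨t, ht, k, v, rfl⟩ := exists_eq_smul_symJ_add_sum_symSquare hA
    rw [map_add, map_smul, map_sum]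
    exact add_nonneg (mul_nonneg ht hJ.le) (Finset.sum_nonneg fun i _ => hs _)
  · rintro ⟨α, hα, rfl⟩
    refine ⟨?_, PointedCone.smul_mem _ hα (symSquare_mem_copositiveCone _ _)⟩
    rw [map_smul, hsq, dotProduct_comm y x, hxy, smul_eq_mul]
    ring
  · rintro ⟨h0, hA⟩
    obtain ⟨t, ht, k, v, rfl⟩ := exists_eq_smul_symJ_add_sum_symSquare hA
    rw [map_add, map_smul, map_sum, smul_eq_mul] at h0
    have h1 := mul_nonneg ht hJ.le
    have h2 : 0 ≤ ∑ i, symInner (m + 1) H (symSquare (v i)) := Finset.sum_nonneg fun i _ => hs _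
    have h3 : ∑ i, symInner (m + 1) H (symSquare (v i)) = 0 := by linarith
    have ht0 : t = 0 := by
      have : t * symInner (m + 1) H (symJ m) = 0 := by linarith
      exact (mul_eq_zero.1 this).resolve_right hJ.ne'
    rw [ht0, zero_smul, zero_add]
    refine sum_symSquare_mem_rayCone fun i => exists_eq_smul_of_dotProduct_sq_eq hx0 ?_
    have h := (Finset.sum_eq_zero_iff_of_nonneg fun i _ => hs (v i)).1 h3 i (Finset.mem_univ i)
    rw [hsq] at h
    have h4 : 0 ≤ r * (y ⬝ᵥ v i) ^ 2 := by positivity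
    have := dotProduct_sq_le x (v i)
    linarith

/-- No positive multiple of the Lorentz form is dominated by the square of a functional that is
tangent to the cone. -/
theorem nonpos_of_mul_lorentzForm_le {x : Fin (m + 1) → ℝ} (hx0 : x ≠ 0)
    (hx : lorentzForm x = 0) {τ c : ℝ} (h : ∀ z, τ * lorentzForm z ≤ c * (x ⬝ᵥ z) ^ 2) :
    τ ≤ 0 := by
  have hxx : 0 < x ⬝ᵥ x :=
    lt_of_le_of_ne (by simpa using dotProduct_star_self_nonneg x) (by simpa [eq_comm] using hx0)
  by_contra! hτ
  have key : ∀ s : ℝ, 0 < s → 2 * τ ≤ c * s * (x ⬝ᵥ x) := by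
    intro s hs
    have h1 := h (timeReflect x + s • x)
    rw [lorentzForm_add_smul, lorentzForm_timeReflect, hx, timeReflect_dotProduct_timeReflect,
      dotProduct_add, dotProduct_smul, dotProduct_timeReflect_self, hx, smul_eq_mul] at h1
    have h2 : (s * (x ⬝ᵥ x)) * (2 * τ) ≤ (s * (x ⬝ᵥ x)) * (c * s * (x ⬝ᵥ x)) := by nlinarith
    exact le_of_mul_le_mul_left h2 (by positivity)
  rcases le_or_gt c 0 with hc | hc
  · have := key 1 one_pos
    nlinarith
  · have := key (τ / (c * (x ⬝ᵥ x))) (by positivity)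
    have e : c * (τ / (c * (x ⬝ᵥ x))) * (x ⬝ᵥ x) = τ := by field_simp
    linarith

/-- The ray through `x xᵀ`, with `x` a nonzero null vector, is a face. -/
theorem isFaceOf_rayCone_symSquare {x : Fin (m + 1) → ℝ} (hx0 : x ≠ 0)
    (hx : lorentzForm x = 0) :
    (rayCone (symSquare x)).IsFaceOf (copositiveCone (secondOrderCone m)) := by
  refine ⟨?_, ?_⟩
  · rintro _ ⟨α, hα, rfl⟩
    exact PointedCone.smul_mem _ hα (symSquare_mem_copositiveCone _ _)
  rintro A B a hA hB ha ⟨c, hc, hAB⟩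
  obtain ⟨t, ht, k, v, rfl⟩ := exists_eq_smul_symJ_add_sum_symSquare hA
  obtain ⟨s, hs, l, w, rfl⟩ := exists_eq_smul_symJ_add_sum_symSquare hB
  have eval : ∀ (t : ℝ) (k : ℕ) (v : Fin k → Fin (m + 1) → ℝ) (z : Fin (m + 1) → ℝ),
      symInner (m + 1) (symSquare z) (t • symJ m + ∑ i, symSquare (v i)) =
        t * lorentzForm z + ∑ i, (v i ⬝ᵥ z) ^ 2 := by
    intro t k v z
    rw [map_add, map_smul, map_sum, symInner_comm, symInner_symSquare, dotProduct_symJ_mulVec]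
    simp only [symInner_symSquare_symSquare, smul_eq_mul, dotProduct_comm z]
  have hz : ∀ z, a * (t * lorentzForm z + ∑ i, (v i ⬝ᵥ z) ^ 2) +
      (s * lorentzForm z + ∑ i, (w i ⬝ᵥ z) ^ 2) = c * (x ⬝ᵥ z) ^ 2 := by
    intro z
    have h := congrArg (symInner (m + 1) (symSquare z)) hAB
    rwa [map_add, map_smul, eval, eval, map_smul, symInner_symSquare_symSquare,
      dotProduct_comm z x] at h
  have hv0 : ∀ z, 0 ≤ ∑ i, (v i ⬝ᵥ z) ^ 2 := fun z => Finset.sum_nonneg fun i _ => sq_nonneg _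
  have hw0 : ∀ z, 0 ≤ ∑ i, (w i ⬝ᵥ z) ^ 2 := fun z => Finset.sum_nonneg fun i _ => sq_nonneg _
  have hτ : a * t + s ≤ 0 := nonpos_of_mul_lorentzForm_le hx0 hx (c := c) fun z => by
    nlinarith [hz z, mul_nonneg ha.le (hv0 z), hw0 z]
  have hat : a * t = 0 := by linarith [mul_nonneg ha.le ht]
  have hs0 : s = 0 := by linarith
  have ht0 : t = 0 := (mul_eq_zero.1 hat).resolve_left ha.ne'
  subst hs0 ht0
  rw [zero_smul, zero_add]
  refine sum_symSquare_mem_rayCone fun i => exists_eq_smul_of_dotProduct_sq_eq hx0 ?_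
  have h1 := hz ((x ⬝ᵥ x) • v i - (x ⬝ᵥ v i) • x)
  set z := (x ⬝ᵥ x) • v i - (x ⬝ᵥ v i) • x with hzdef
  have hxz : x ⬝ᵥ z = 0 := by
    rw [hzdef, dotProduct_sub, dotProduct_smul, dotProduct_smul, smul_eq_mul, smul_eq_mul]
    ring
  rw [hxz] at h1
  have h2 : ∑ i, (v i ⬝ᵥ z) ^ 2 = 0 := by
    have : a * ∑ i, (v i ⬝ᵥ z) ^ 2 = 0 := by linarith [mul_nonneg ha.le (hv0 z), hw0 z]
    exact (mul_eq_zero.1 this).resolve_left ha.ne'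
  have h3 := (Finset.sum_eq_zero_iff_of_nonneg fun i _ => sq_nonneg (v i ⬝ᵥ z)).1 h2 i
    (Finset.mem_univ i)
  have h4 : v i ⬝ᵥ z = 0 := by simpa using h3
  rw [hzdef, dotProduct_sub, dotProduct_smul, dotProduct_smul, smul_eq_mul, smul_eq_mul,
    dotProduct_comm (v i) x] at h4
  linear_combination h4

/-- The ray through `x xᵀ`, with `x` a nonzero null vector, is not exposed. -/
theorem not_isExposedFace_rayCone_symSquare (hm : 1 ≤ m) {x : Fin (m + 1) → ℝ} (hx0 : x ≠ 0)
    (hx : lorentzForm x = 0) :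
    ¬ IsExposedFace (symInner (m + 1)) (rayCone (symSquare x))
      (copositiveCone (secondOrderCone m)) := by
  rintro ⟨-, H, hH, heq⟩
  have hH' : ∀ A ∈ copositiveCone (secondOrderCone m), 0 ≤ symInner (m + 1) H A := by
    intro A hA
    rw [symInner_comm]
    exact hH hA
  have hxx : 0 < x ⬝ᵥ x :=
    lt_of_le_of_ne (by simpa using dotProduct_star_self_nonneg x) (by simpa [eq_comm] using hx0)
  have hHx : symInner (m + 1) H (symSquare x) = 0 := by
    have : symSquare x ∈ (rayCone (symSquare x) : Set (symMat (m + 1))) := self_mem_rayCone _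
    rw [heq] at this
    exact this.1
  set u := timeReflect x
  have bound : ∀ s : ℝ, 0 < s →
      symInner (m + 1) H (symJ m) * (x ⬝ᵥ x) ≤ s * symInner (m + 1) H (symSquare u) := by
    intro s hs
    have hq : lorentzForm (x + s • u) = 2 * s * (x ⬝ᵥ x) := by
      rw [lorentzForm_add_smul, lorentzForm_timeReflect, hx, timeReflect_timeReflect]
      ring
    have h1 := hH' _ (symSquare_sub_smul_symJ_mem (v := x + s • u) (by rw [hq]; positivity))
    have h2 := hH' _ (symSquare_mem_copositiveCone _ (x - s • u))
    have h3 := congrArg (symInner (m + 1) H) (symSquare_add_add_symSquare_sub x (s • u))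
    rw [map_sub, map_smul, hq, smul_eq_mul] at h1
    rw [map_add, map_add, map_smul, map_smul, hHx, symSquare_smul, map_smul] at h3
    simp only [smul_eq_mul] at h3
    have h4 : (2 * s) * (symInner (m + 1) H (symJ m) * (x ⬝ᵥ x)) ≤
      (2 * s) * (s * symInner (m + 1) H (symSquare u)) := by linarith
    exact le_of_mul_le_mul_left h4 (by positivity)
  have hle : symInner (m + 1) H (symJ m) * (x ⬝ᵥ x) ≤ 0 := by
    have hlim : Filter.Tendsto (fun s : ℝ => s * symInner (m + 1) H (symSquare u))
        (nhdsWithin 0 (Set.Ioi 0)) (nhds 0) := by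
      have : Continuous fun s : ℝ => s * symInner (m + 1) H (symSquare u) := by fun_prop
      simpa using (this.tendsto 0).mono_left nhdsWithin_le_nhds
    exact ge_of_tendsto hlim (Filter.eventually_of_mem self_mem_nhdsWithin bound)
  have hJ0 : symInner (m + 1) H (symJ m) = 0 :=
    le_antisymm (nonpos_of_mul_nonpos_left hle hxx) (hH' _ symJ_mem_copositiveCone)
  have hmem : symJ m ∈ (rayCone (symSquare x) : Set (symMat (m + 1))) := by
    rw [heq]
    exact ⟨hJ0, symJ_mem_copositiveCone⟩
  obtain ⟨α, -, hα⟩ := hmem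
  exact symJ_ne_smul_symSquare hm α x hα

/-- An extreme ray is generated by `J` or by the square of a vector not interior to the double
cone. -/
theorem IsExtremeRay.eq_rayCone (hm : 1 ≤ m) {R : PointedCone ℝ (symMat (m + 1))}
    (hR : IsExtremeRay R (copositiveCone (secondOrderCone m))) :
    R = rayCone (symJ m) ∨ ∃ x, x ≠ 0 ∧ lorentzForm x ≤ 0 ∧ R = rayCone (symSquare x) := by
  obtain ⟨hface, hdim⟩ := hR
  have gen : ∀ {A}, A ∈ R → A ≠ 0 → R = rayCone A := fun hA hA0 =>
    eq_rayCone_of_coneDim_eq_one hface.le (fun _ => eq_zero_of_mem_of_neg_mem) hdim hA hA0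
  obtain ⟨A, hA, hA0⟩ : ∃ A ∈ R, A ≠ 0 := by
    by_contra! h
    have : Submodule.span ℝ (R : Set (symMat (m + 1))) = ⊥ := Submodule.span_eq_bot.2 h
    rw [coneDim, this, finrank_bot] at hdim
    exact zero_ne_one hdim
  obtain ⟨t, ht, k, v, rfl⟩ := exists_eq_smul_symJ_add_sum_symSquare (hface.le hA)
  have hsum : ∑ i, symSquare (v i) ∈ copositiveCone (secondOrderCone m) :=
    Submodule.sum_mem _ fun i _ => symSquare_mem_copositiveCone _ _
  rcases ht.eq_or_lt with rfl | ht
  · rw [zero_smul, zero_add] at hA hA0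
    obtain ⟨i, -, hi⟩ := Finset.exists_ne_zero_of_sum_ne_zero hA0
    have hiR := hface.mem_of_sum_mem (fun i => symSquare_mem_copositiveCone _ _) hA i
    have hRi := gen hiR hi
    refine Or.inr ⟨v i, fun h => hi (by rw [h, symSquare_zero]), ?_, hRi⟩
    by_contra! hpos
    have hJR : symJ m ∈ R := by
      refine hface.mem_of_smul_add_mem symJ_mem_copositiveCone
        (symSquare_sub_smul_symJ_mem hpos) hpos ?_
      rwa [add_sub_cancel]
    rw [hRi] at hJR
    obtain ⟨α, -, hα⟩ := hJR
    exact symJ_ne_smul_symSquare hm α _ hα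
  · exact Or.inl (gen (hface.mem_of_smul_add_mem symJ_mem_copositiveCone hsum ht hA) symJ_ne_zero)

end ExtremeRays

theorem mainTheorem4 (m : ℕ) (hm : 1 ≤ m) :
    (∀ R : PointedCone ℝ (symMat (m + 1)),
      IsExtremeRay R (copositiveCone (secondOrderCone m)) ↔
        (∃ x : Fin (m + 1) → ℝ, x ∉ secondOrderCone m ∪ -secondOrderCone m ∧
          R = rayCone (symSquare x)) ∨
        R = rayCone (symJ m) ∨
        (∃ x : Fin (m + 1) → ℝ, x ∈ frontier (secondOrderCone m) \ {0} ∧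
          R = rayCone (symSquare x))) ∧
    (∀ x : Fin (m + 1) → ℝ, x ∉ secondOrderCone m ∪ -secondOrderCone m →
      IsExposedFace (symInner (m + 1)) (rayCone (symSquare x))
        (copositiveCone (secondOrderCone m))) ∧
    IsExposedFace (symInner (m + 1)) (rayCone (symJ m)) (copositiveCone (secondOrderCone m)) ∧
    (∀ x : Fin (m + 1) → ℝ, x ∈ frontier (secondOrderCone m) \ {0} →
      ¬ IsExposedFace (symInner (m + 1)) (rayCone (symSquare x))
        (copositiveCone (secondOrderCone m))) := by
  simp only [mem_secondOrderCone_union_neg_iff, not_le, Set.mem_sdiff, Set.mem_singleton_iff,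
    mem_frontier_secondOrderCone_iff]
  refine ⟨fun R => ⟨fun hR => ?_, ?_⟩, fun x hx => isExposedFace_rayCone_symSquare hx,
    isExposedFace_rayCone_symJ hm,
    fun x hx => not_isExposedFace_rayCone_symSquare hm hx.2 hx.1.2⟩
  · rcases hR.eq_rayCone hm with h | ⟨x, hx0, hx, h⟩
    · exact Or.inr (Or.inl h)
    rcases hx.lt_or_eq with hx | hx
    · exact Or.inl ⟨x, hx, h⟩
    · refine Or.inr (Or.inr ?_)
      rcases le_total 0 (x 0) with h0 | h0
      · exact ⟨x, ⟨⟨h0, hx⟩, hx0⟩, h⟩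
      · exact ⟨-x, ⟨⟨by simpa using h0, by rw [lorentzForm_neg, hx]⟩, neg_ne_zero.2 hx0⟩,
          by rw [symSquare_neg, h]⟩
  · rintro (⟨x, hx, rfl⟩ | rfl | ⟨x, ⟨⟨-, hx⟩, hx0⟩, rfl⟩)
    · have hx0 : x ≠ 0 := by
        rintro rfl
        simp [lorentzForm] at hx
      exact ⟨(isExposedFace_rayCone_symSquare hx).1, coneDim_rayCone (symSquare_ne_zero hx0)⟩
    · exact ⟨(isExposedFace_rayCone_symJ hm).1, coneDim_rayCone symJ_ne_zero⟩
    · exact ⟨isFaceOf_rayCone_symSquare hx0 hx, coneDim_rayCone (symSquare_ne_zero hx0)⟩
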